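/- Let $\mathbb{K}$ be a field and let $A=\bigoplus_{n\ge 0}A_n$ be an $\mathbb{N}$-graded $\mathbb{K}$-algebra that is connected ($A_0=\mathbb{K}$), locally finite ($\dim_{\mathbb{K}}A_n<\infty$ for all $n$) and generated in degree one. Regard $\mathbb{K}=A/A_{\ge 1}$ as the trivial graded $A$-module. Suppose that $A$ is Artin–Schelter regular of dimension $d$, that is: 1. $A$ has finite global dimension $d$; 2. $A$ is Gorenstein: there is an integer $l$ such that the graded Ext spaces satisfy $\underline{\mathrm{Ext}}^i_A(\mathbb{K},A)=0$ for $i\ne d$ and $\underline{\mathrm{Ext}}^d_A(\mathbb{K},A)\cong\mathbb{K}(l)$, the trivial module placed in degree $-l$; 3. $A$ has finite Gelfand–Kirillov dimension: there are positive real constants $c,e$ with $\dim_{\mathbb{K}}A_n\le c\,n^{e}$ for all $n\ge 1$. Suppose also that $A$ is Koszul, that is, $\mathbb{K}$ has a graded free resolution $\cdots\to P_1\to P_0\to\mathbb{K}\to 0$ in which each $P_i$ is a direct sum of copies of $A(-i)$. Finally, suppose that $\mathrm{GKdim}(A)\ge d-1$, where $$\mathrm{GKdim}(A)=\sup_V\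 \limsup_{n\to\infty}\ \log_n\left(\dim_{\mathbb{K}}V^n\right),$$ the supremum being over all finite-dimensional subspaces $V\subseteq A$ that contain $1$. Then the Hilbert series $h_A(t)=\sum_{n\ge 0}(\dim_{\mathbb{K}}A_n)\,t^n$ of $A$ is $$h_A(t)=\frac{1}{(1-t)^d}.$$ -/

import Mathlib

open CategoryTheory

universe u v

namespace ASKoszul

noncomputable section

/-- The (left) global dimension of a ring: the supremum of the projective dimensions of its
modules. -/
def globalDimension (A : Type v) [Ring A] : WithBot ℕ∞ :=
  ⨆ M : ModuleCat.{v} A, projectiveDimension M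

/-- The Gelfand-Kirillov dimension of a `K`-algebra `A`: the supremum, over all finite-dimensional
subspaces `V` of `A` that contain `1`, of `limsup_n log_n (dim_K V ^ n)`. -/
def gkDim (K : Type u) (A : Type v) [Field K] [Ring A] [Algebra K A] : EReal :=
  ⨆ (V : Submodule K A) (_ : V.FG) (_ : (1 : A) ∈ V),
    Filter.limsup
      (fun n : ℕ => ((Real.logb (n : ℝ) (Module.finrank K ↥(V ^ n) : ℝ) : ℝ) : EReal))
      Filter.atTop

variable {K : Type u} {A : Type v} [Field K] [Ring A] [Algebra K A]

/-- The Hilbert series `∑ n, (dim_K A_n) t ^ n` of a graded algebra. -/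
def hilbertSeries (𝒜 : ℕ → Submodule K A) : PowerSeries ℚ :=
  PowerSeries.mk fun n => (Module.finrank K (𝒜 n) : ℚ)

/-- The standing conventions on an `ℕ`-graded `K`-algebra: it is connected (nonzero, and its
component of degree `0` is the image of `K`), locally finite, and generated in degree one. -/
structure IsStandardGraded (𝒜 : ℕ → Submodule K A) : Prop where
  nontrivial : Nontrivial A
  connected : 𝒜 0 = 1
  locallyFinite : ∀ n, Module.Finite K (𝒜 n)
  generated : Algebra.adjoin K (𝒜 1 : Set A) = ⊤

/-- The component of degree `n` of `A`, extended by zero to negative integers `n`. -/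
def intComponent (𝒜 : ℕ → Submodule K A) (n : ℤ) : Submodule K A :=
  if 0 ≤ n then 𝒜 n.toNat else ⊥

/-- The component of degree `n` of the graded free left `A`-module `⨁ s : ι, A(-α s)`, the free
module on generators `s` of degree `α s`. -/
def freeComponent (𝒜 : ℕ → Submodule K A) {ι : Type v} (α : ι → ℤ) (n : ℤ) :
    Submodule K (ι →₀ A) where
  carrier := {f | ∀ s, f s ∈ intComponent 𝒜 (n - α s)}
  zero_mem' := fun _ => Submodule.zero_mem _
  add_mem' := fun hf hg s => Submodule.add_mem _ (hf s) (hg s)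
  smul_mem' := fun c _ hf s => Submodule.smul_mem _ c (hf s)

/-- The trivial left `A`-module `A / A_{≥ 1}` (for a connected algebra this is `K`). It is regarded
as a graded module concentrated in degree `0`. -/
abbrev TrivialModule (𝒜 : ℕ → Submodule K A) [GradedAlgebra 𝒜] : Type v :=
  A ⧸ (HomogeneousIdeal.irrelevant 𝒜).toIdeal

/-- A graded free resolution `⋯ → P 1 → P 0 → K → 0` of the trivial left `A`-module, where
`P i = ⨁ s : ι i, A(-deg i s)`; all the maps are homogeneous of degree `0`. Neither minimality nor
finiteness is required. -/
structure GradedFreeResolution (𝒜 : ℕ → Submodule K A) [GradedAlgebra 𝒜] where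
  /-- the index set of the basis of `P i` -/
  ι : ℕ → Type v
  /-- the degrees of the basis elements of `P i` -/
  deg : ∀ i, ι i → ℤ
  /-- the differential `P (i + 1) → P i` -/
  d : ∀ i, (ι (i + 1) →₀ A) →ₗ[A] (ι i →₀ A)
  /-- the augmentation `P 0 → K` -/
  ε : (ι 0 →₀ A) →ₗ[A] TrivialModule 𝒜
  d_homogeneous : ∀ (i : ℕ) (n : ℤ), ∀ x ∈ freeComponent 𝒜 (deg (i + 1)) n,
    d i x ∈ freeComponent 𝒜 (deg i) n
  ε_homogeneous : ∀ n : ℤ, n ≠ 0 → ∀ x ∈ freeComponent 𝒜 (deg 0) n, ε x = 0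
  ε_surjective : Function.Surjective ε
  exact_zero : Function.Exact (d 0) ε
  exact_succ : ∀ i, Function.Exact (d (i + 1)) (d i)

namespace GradedFreeResolution

variable {𝒜 : ℕ → Submodule K A} [GradedAlgebra 𝒜] (R : GradedFreeResolution 𝒜)

/-- The `A`-linear maps `P i → A` that are homogeneous of degree `n`: the degree `n` component of
the graded Hom space from `P i` to `A`. -/
def homDegree (i : ℕ) (n : ℤ) : Submodule K ((R.ι i →₀ A) →ₗ[A] A) where
  carrier := {φ | ∀ m : ℤ, ∀ x ∈ freeComponent 𝒜 (R.deg i) m, φ x ∈ intComponent 𝒜 (m + n)}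
  zero_mem' := fun _ _ _ => Submodule.zero_mem _
  add_mem' := fun hf hg m x hx => Submodule.add_mem _ (hf m x hx) (hg m x hx)
  smul_mem' := fun c _ hf m x hx => Submodule.smul_mem _ c (hf m x hx)

/-- The cocycles of degree `n` in cohomological degree `i` of the complex `Hom(P, A)`. -/
def cocycles (i : ℕ) (n : ℤ) : Submodule K ((R.ι i →₀ A) →ₗ[A] A) where
  carrier := {φ | φ ∈ R.homDegree i n ∧ φ ∘ₗ R.d i = 0}
  zero_mem' := ⟨Submodule.zero_mem _, LinearMap.zero_comp _⟩
  add_mem' := fun hf hg => ⟨Submodule.add_mem _ hf.1 hg.1, by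
    rw [LinearMap.add_comp, hf.2, hg.2, add_zero]⟩
  smul_mem' := fun c _ hf => ⟨Submodule.smul_mem _ c hf.1, by
    rw [LinearMap.smul_comp, hf.2, smul_zero]⟩

/-- The coboundaries of degree `n` in cohomological degree `i` of the complex `Hom(P, A)`. -/
def coboundaries : (i : ℕ) → (n : ℤ) → Submodule K ((R.ι i →₀ A) →ₗ[A] A)
  | 0, _ => ⊥
  | i + 1, n =>
    { carrier := {φ | ∃ ψ ∈ R.homDegree i n, ψ ∘ₗ R.d i = φ}
      zero_mem' := ⟨0, Submodule.zero_mem _, LinearMap.zero_comp _⟩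
      add_mem' := by
        rintro _ _ ⟨f, hf, rfl⟩ ⟨g, hg, rfl⟩
        exact ⟨f + g, Submodule.add_mem _ hf hg, LinearMap.add_comp _ _ _⟩
      smul_mem' := by
        rintro c _ ⟨f, hf, rfl⟩
        exact ⟨c • f, Submodule.smul_mem _ c hf, LinearMap.smul_comp _ _ _⟩ }

/-- The degree `n` component of the graded Ext space `Ext^i_A(K, A)`, computed by the resolution
`R`: cocycles modulo coboundaries, as a subspace of the space of all maps modulo coboundaries. -/
def Ext (i : ℕ) (n : ℤ) : Submodule K (((R.ι i →₀ A) →ₗ[A] A) ⧸ R.coboundaries i n) :=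
  (R.cocycles i n).map (R.coboundaries i n).mkQ

end GradedFreeResolution

/-- The graded Ext spaces of `K` and `A` are `0` in cohomological degrees `i ≠ d`, and `K(l)`, which
is one-dimensional and concentrated in degree `-l`, for `i = d`. (Every resolution computes the same
Ext spaces. A graded module of this size over a connected algebra is automatically trivial, because
`A_{≥ 1}` annihilates it for degree reasons.) -/
def IsGorensteinOfIndex (𝒜 : ℕ → Submodule K A) [GradedAlgebra 𝒜] (d : ℕ) (l : ℤ) : Prop :=
  ∀ R : GradedFreeResolution 𝒜,
    (∀ (i : ℕ) (n : ℤ), ¬(i = d ∧ n = -l) → R.Ext i n = ⊥) ∧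
      Module.finrank K (R.Ext d (-l)) = 1

/-- Artin-Schelter regular algebras of dimension `d`. -/
structure IsASRegular (𝒜 : ℕ → Submodule K A) [GradedAlgebra 𝒜] (d : ℕ) : Prop where
  globalDimension_eq : globalDimension A = d
  gorenstein : ∃ l : ℤ, IsGorensteinOfIndex 𝒜 d l
  polynomial_growth : ∃ c e : ℝ, 0 < c ∧ 0 < e ∧
    ∀ n : ℕ, 1 ≤ n → (Module.finrank K (𝒜 n) : ℝ) ≤ c * (n : ℝ) ^ e

/-- `A` is Koszul if the trivial module has a linear graded free resolution: one whose `i`-th term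
is a direct sum of copies of `A(-i)`. -/
def IsKoszul (𝒜 : ℕ → Submodule K A) [GradedAlgebra 𝒜] : Prop :=
  ∃ R : GradedFreeResolution 𝒜, ∀ (i : ℕ) (s : R.ι i), R.deg i s = i

end

end ASKoszul

/-! Let `b_i` be the rank of the `i`-th term of a linear resolution of the trivial module. Linearity
forces minimality, so the resolution stops at the global dimension: `b_{d+1} = 0`
(`isEmpty_of_hasProjectiveDimensionLT`). The ranks are finite, and Euler characteristics in each
degree give `q(t) h_A(t) = 1` with `q = ∑ i ≤ d, (-1)^i b_i t^i`
(`eulerPolynomial_mul_hilbertSeries`). The Gorenstein condition enters through `Ext^d ≠ 0`, which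
gives `b_d ≥ 1`.

Polynomial growth makes `h_A` converge on `|t| < 1`, so `q` has no zero there. If `1` is a root of
`q` of multiplicity `m`, the blow-up of `h_A` at `1` bounds the partial sums of its coefficients by
a multiple of `N^m` (`exists_sum_range_le`), hence `GKdim A ≤ m` (`gkDim_le`), and so `m ≥ d - 1`.
For `d ≥ 1`, `q` is therefore `(t - 1)^(d-1)` times a linear factor; the extreme coefficients of `q`
identify that factor as `± (b_d t - 1)`. Its root `1 / b_d` may not lie in `(0, 1)`, so `b_d = 1`
and `q = (1 - t)^d` (`eq_one_sub_X_pow`). -/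

namespace ASKoszul
noncomputable section

/-! ### Homogeneous components of graded free modules -/

section Components

variable {K : Type u} {A : Type v} [Field K] [Ring A] [Algebra K A] (𝒜 : ℕ → Submodule K A)

theorem intComponent_natCast (n : ℕ) : intComponent 𝒜 n = 𝒜 n := by
  simp [intComponent]

theorem intComponent_of_neg {n : ℤ} (hn : n < 0) : intComponent 𝒜 n = ⊥ :=
  if_neg (not_le.2 hn)

theorem single_mem_freeComponent {ι : Type v} (α : ι → ℤ) {n : ℤ} {s : ι} {a : A}
    (ha : a ∈ intComponent 𝒜 (n - α s)) : Finsupp.single s a ∈ freeComponent 𝒜 α n := by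
  classical
  intro t
  by_cases h : s = t
  · subst h; simpa using ha
  · simp [Finsupp.single_eq_of_ne' h]

theorem freeComponent_eq_bot {ι : Type v} {α : ι → ℤ} {n : ℤ} (h : ∀ s, n < α s) :
    freeComponent 𝒜 α n = ⊥ := by
  rw [eq_bot_iff]
  intro f hf
  ext s
  have := hf s
  rw [intComponent_of_neg 𝒜 (by linarith [h s])] at this
  simpa using this

/-- The component of degree `n` of a graded free module all of whose generators have degree `c`. -/
def freeComponentEquiv {ι : Type v} {α : ι → ℤ} {c : ℤ} (h : ∀ s, α s = c) (n : ℤ) :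
    freeComponent 𝒜 α n ≃ₗ[K] (ι →₀ intComponent 𝒜 (n - c)) where
  toFun f := Finsupp.ofSupportFinite (fun s => ⟨f.1 s, h s ▸ f.2 s⟩)
    (f.1.hasFiniteSupport.subset fun s hs hf => hs (Subtype.ext hf))
  invFun f := ⟨f.mapRange Subtype.val rfl, fun s => by simp [h s]⟩
  map_add' f g := by ext; rfl
  map_smul' f g := by ext; rfl
  left_inv f := by ext; rfl
  right_inv f := by ext; rfl

variable [GradedAlgebra 𝒜]

/-- The projection of `A` onto its component of integer degree `n`. -/
def intProj (n : ℤ) : A →ₗ[K] A :=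
  if 0 ≤ n then GradedAlgebra.proj 𝒜 n.toNat else 0

theorem intProj_of_mem {k : ℕ} {a : A} (ha : a ∈ 𝒜 k) (n : ℤ) :
    intProj 𝒜 n a = if n = k then a else 0 := by
  unfold intProj
  split_ifs with h1 h2 h2
  · subst h2
    simpa [GradedAlgebra.proj_apply] using DirectSum.decompose_of_mem_same 𝒜 ha
  · rw [GradedAlgebra.proj_apply]
    exact DirectSum.decompose_of_mem_ne 𝒜 ha (by omega)
  · omega
  · rfl

theorem intProj_mem (n : ℤ) (a : A) : intProj 𝒜 n a ∈ intComponent 𝒜 n := by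
  unfold intProj intComponent
  split_ifs
  · rw [GradedAlgebra.proj_apply]; exact SetLike.coe_mem _
  · simp

theorem intProj_of_mem_intComponent {m : ℤ} {a : A} (ha : a ∈ intComponent 𝒜 m) (n : ℤ) :
    intProj 𝒜 n a = if n = m then a else 0 := by
  unfold intComponent at ha
  split_ifs at ha with h
  · rw [intProj_of_mem 𝒜 ha, Int.toNat_of_nonneg h]
  · simp [(Submodule.mem_bot K).1 ha]

/-- The projection of a graded free module onto its component of degree `n`. -/
def freeProj {ι : Type v} (α : ι → ℤ) (n : ℤ) : (ι →₀ A) →ₗ[K] (ι →₀ A) where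
  toFun f := Finsupp.ofSupportFinite (fun s => intProj 𝒜 (n - α s) (f s))
    (f.hasFiniteSupport.subset fun s hs hf => hs (by simp [hf]))
  map_add' f g := by ext s; exact map_add (intProj 𝒜 (n - α s)) (f s) (g s)
  map_smul' c f := by ext s; exact map_smul (intProj 𝒜 (n - α s)) c (f s)

variable {ι ι' : Type v} {α : ι → ℤ} {β : ι' → ℤ}

theorem freeProj_apply (n : ℤ) (f : ι →₀ A) (s : ι) :
    freeProj 𝒜 α n f s = intProj 𝒜 (n - α s) (f s) := rfl

theorem freeProj_mem (n : ℤ) (f : ι →₀ A) : freeProj 𝒜 α n f ∈ freeComponent 𝒜 α n :=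
  fun s => intProj_mem 𝒜 (n - α s) (f s)

theorem freeProj_of_mem {m : ℤ} {f : ι →₀ A} (hf : f ∈ freeComponent 𝒜 α m) (n : ℤ) :
    freeProj 𝒜 α n f = if n = m then f else 0 := by
  ext s
  rw [freeProj_apply, intProj_of_mem_intComponent 𝒜 (hf s)]
  by_cases h : n = m <;> simp [h]

/-- A graded free module is spanned by its homogeneous elements. -/
theorem free_induction (α : ι → ℤ) {p : (ι →₀ A) → Prop} (zero : p 0)
    (add : ∀ f g, p f → p g → p (f + g))
    (homogeneous : ∀ n, ∀ f ∈ freeComponent 𝒜 α n, p f) (f : ι →₀ A) : p f := by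
  induction f using Finsupp.induction_linear with
  | zero => exact zero
  | add f g hf hg => exact add f g hf hg
  | single s a =>
    induction a using DirectSum.Decomposition.inductionOn 𝒜 with
    | zero => simpa using zero
    | @homogeneous i m =>
      refine homogeneous (i + α s) _ (single_mem_freeComponent 𝒜 α ?_)
      rw [add_sub_cancel_right, intComponent_natCast]
      exact m.2
    | add m m' h h' => rw [Finsupp.single_add]; exact add _ _ h h'

/-- Both sides are additive in `f`, so homogeneous `f` suffice. This is what lets preimages under a
differential be made homogeneous. -/
theorem map_freeProj (d : (ι →₀ A) →ₗ[A] (ι' →₀ A))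
    (hd : ∀ n, ∀ x ∈ freeComponent 𝒜 α n, d x ∈ freeComponent 𝒜 β n) (n : ℤ) (f : ι →₀ A) :
    d (freeProj 𝒜 α n f) = freeProj 𝒜 β n (d f) := by
  induction f using free_induction 𝒜 α with
  | zero => simp
  | add f g hf hg => simp only [map_add, hf, hg]
  | homogeneous m f hf =>
    rw [freeProj_of_mem 𝒜 hf, freeProj_of_mem 𝒜 (hd m f hf)]
    split_ifs <;> simp

end Components

/-! ### The resolution in a fixed degree -/

namespace GradedFreeResolution

variable {K : Type u} {A : Type v} [Field K] [Ring A] [Algebra K A]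
  {𝒜 : ℕ → Submodule K A} [GradedAlgebra 𝒜] (R : GradedFreeResolution 𝒜)

theorem ε_freeProj_zero (f : R.ι 0 →₀ A) : R.ε (freeProj 𝒜 (R.deg 0) 0 f) = R.ε f := by
  induction f using free_induction 𝒜 (R.deg 0) with
  | zero => simp
  | add f g hf hg => simp only [map_add, hf, hg]
  | homogeneous m f hf =>
    rw [freeProj_of_mem 𝒜 hf]
    split_ifs with h
    · rfl
    · rw [R.ε_homogeneous m (Ne.symm h) f hf, map_zero]

/-- Exactness is given for the ungraded modules; the degree `n` part of an arbitrary preimage is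
again a preimage. -/
theorem exists_of_d_eq_zero {i : ℕ} {n : ℤ} {x : R.ι (i + 1) →₀ A}
    (hx : x ∈ freeComponent 𝒜 (R.deg (i + 1)) n) (h : R.d i x = 0) :
    ∃ y ∈ freeComponent 𝒜 (R.deg (i + 2)) n, R.d (i + 1) y = x := by
  obtain ⟨y, rfl⟩ := (R.exact_succ i x).1 h
  refine ⟨_, freeProj_mem 𝒜 n y, ?_⟩
  rw [map_freeProj 𝒜 _ (R.d_homogeneous (i + 1)), freeProj_of_mem 𝒜 hx, if_pos rfl]

theorem exists_of_ε_eq_zero {n : ℤ} {x : R.ι 0 →₀ A}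
    (hx : x ∈ freeComponent 𝒜 (R.deg 0) n) (h : R.ε x = 0) :
    ∃ y ∈ freeComponent 𝒜 (R.deg 1) n, R.d 0 y = x := by
  obtain ⟨y, rfl⟩ := (R.exact_zero x).1 h
  refine ⟨_, freeProj_mem 𝒜 n y, ?_⟩
  rw [map_freeProj 𝒜 _ (R.d_homogeneous 0), freeProj_of_mem 𝒜 hx, if_pos rfl]

/-- The differential `P (i + 1) → P i` in degree `n`. -/
def dDegree (i : ℕ) (n : ℤ) :
    freeComponent 𝒜 (R.deg (i + 1)) n →ₗ[K] freeComponent 𝒜 (R.deg i) n :=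
  ((R.d i).restrictScalars K).restrict (R.d_homogeneous i n)

/-- The augmentation in degree `n`. -/
def εDegree (n : ℤ) : freeComponent 𝒜 (R.deg 0) n →ₗ[K] TrivialModule 𝒜 :=
  (R.ε.restrictScalars K).domRestrict _

theorem range_dDegree_succ (i : ℕ) (n : ℤ) :
    LinearMap.range (R.dDegree (i + 1) n) = LinearMap.ker (R.dDegree i n) := by
  ext x
  rw [LinearMap.mem_range, LinearMap.mem_ker]
  constructor
  · rintro ⟨y, rfl⟩
    exact Subtype.ext (R.exact_succ i |>.apply_apply_eq_zero y.1)
  · intro h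
    obtain ⟨y, hy, h⟩ := R.exists_of_d_eq_zero x.2 (congrArg Subtype.val h)
    exact ⟨⟨y, hy⟩, Subtype.ext h⟩

theorem range_dDegree_zero (n : ℤ) :
    LinearMap.range (R.dDegree 0 n) = LinearMap.ker (R.εDegree n) := by
  ext x
  rw [LinearMap.mem_range, LinearMap.mem_ker]
  constructor
  · rintro ⟨y, rfl⟩
    exact R.exact_zero.apply_apply_eq_zero y.1
  · intro h
    obtain ⟨y, hy, h⟩ := R.exists_of_ε_eq_zero x.2 h
    exact ⟨⟨y, hy⟩, Subtype.ext h⟩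

theorem εDegree_zero_surjective : Function.Surjective (R.εDegree 0) := by
  intro x
  obtain ⟨y, rfl⟩ := R.ε_surjective x
  exact ⟨⟨_, freeProj_mem 𝒜 0 y⟩, R.ε_freeProj_zero y⟩

theorem εDegree_of_ne {n : ℤ} (hn : n ≠ 0) : R.εDegree n = 0 := by
  ext x
  exact R.ε_homogeneous n hn x.1 x.2

end GradedFreeResolution

theorem finrank_trivialModule {K : Type u} {A : Type v} [Field K] [Ring A] [Algebra K A]
    (𝒜 : ℕ → Submodule K A) [GradedAlgebra 𝒜] (hA : IsStandardGraded 𝒜) :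
    Module.finrank K (TrivialModule 𝒜) = 1 := by
  have := hA.nontrivial
  refine finrank_eq_one (Submodule.Quotient.mk 1) ?_ ?_
  · intro h
    rw [Submodule.Quotient.mk_eq_zero] at h
    have h2 : (GradedRing.proj 𝒜 0) 1 = 0 := h
    rw [GradedRing.proj_apply,
      DirectSum.decompose_of_mem_same 𝒜 (SetLike.GradedOne.one_mem (A := 𝒜))] at h2
    exact one_ne_zero h2
  · intro w
    obtain ⟨a, rfl⟩ := Submodule.Quotient.mk_surjective _ w
    have h0 : GradedRing.proj 𝒜 0 a ∈ (1 : Submodule K A) := by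
      rw [← hA.connected, GradedRing.proj_apply]
      exact SetLike.coe_mem _
    obtain ⟨c, hc⟩ := Submodule.mem_one.1 h0
    refine ⟨c, ?_⟩
    rw [← Submodule.Quotient.mk_smul, Submodule.Quotient.eq]
    change GradedRing.proj 𝒜 0 _ = 0
    rw [Algebra.smul_def, mul_one, hc, map_sub, GradedRing.proj_apply, GradedRing.proj_apply,
      DirectSum.decompose_coe, DirectSum.of_eq_same, sub_self]

theorem finrank_intComponent_of_lt {K : Type u} {A : Type v} [Field K] [Ring A] [Algebra K A]
    (𝒜 : ℕ → Submodule K A) {n : ℤ} (hn : n < 0) : Module.finrank K (intComponent 𝒜 n) = 0 := by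
  rw [intComponent_of_neg 𝒜 hn, finrank_bot]

/-- The kernel of a surjection from a projective module onto a module of projective dimension at
most `n + 1` has projective dimension at most `n`. -/
theorem hasProjectiveDimensionLT_ker {A : Type v} [Ring A] {P M : Type v} [AddCommGroup P]
    [AddCommGroup M] [Module A P] [Module A M] [Module.Projective A P] (f : P →ₗ[A] M)
    (hf : Function.Surjective f) (n : ℕ)
    (h : HasProjectiveDimensionLT (ModuleCat.of A M) (n + 2)) :
    HasProjectiveDimensionLT (ModuleCat.of A (LinearMap.ker f)) (n + 1) := by
  let S : ShortComplex (ModuleCat.{v} A) :=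
    ShortComplex.mk (ModuleCat.ofHom (LinearMap.ker f).subtype) (ModuleCat.ofHom f)
      (by ext x; exact x.2)
  have hS : S.ShortExact := by
    refine ShortComplex.ShortExact.mk' ?_ ?_ ?_
    · rw [ShortComplex.moduleCat_exact_iff]
      exact fun x hx => ⟨⟨x, hx⟩, rfl⟩
    · exact (ModuleCat.mono_iff_injective _).2 Subtype.val_injective
    · exact (ModuleCat.epi_iff_surjective _).2 hf
  have : Projective S.X₂ := (IsProjective.iff_projective P).1 inferInstance
  exact (hS.hasProjectiveDimensionLT_X₃_iff n this).1 h

/-! ### Linear resolutions: minimality, finite ranks, Euler characteristic -/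

namespace GradedFreeResolution

variable {K : Type u} {A : Type v} [Field K] [Ring A] [Algebra K A]
  {𝒜 : ℕ → Submodule K A} [GradedAlgebra 𝒜] (R : GradedFreeResolution 𝒜)

/-- The `i`-th syzygy, as a surjection from `P i`: the image of `P i → P (i - 1)`, and the trivial
module for `i = 0`. Its kernel is the image of `P (i + 1) → P i`. -/
theorem exists_syzygy {n : ℕ}
    (h : HasProjectiveDimensionLT (ModuleCat.of A (TrivialModule 𝒜)) (n + 1)) (i : ℕ)
    (hi : i ≤ n) : ∃ (M : ModuleCat.{v} A) (f : (R.ι i →₀ A) →ₗ[A] M),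
      Function.Surjective f ∧ LinearMap.ker f = LinearMap.range (R.d i) ∧
      HasProjectiveDimensionLT M (n - i + 1) := by
  induction i with
  | zero =>
    exact ⟨ModuleCat.of A (TrivialModule 𝒜), R.ε, R.ε_surjective,
      LinearMap.exact_iff.1 R.exact_zero, h⟩
  | succ i ih =>
    obtain ⟨M, f, hf, hk, hM⟩ := ih (by omega)
    -- Dimension shifting; `i + 1 ≤ n` keeps the truncated subtraction honest.
    have h2 := hasProjectiveDimensionLT_ker f hf (n - (i + 1))
      (by rwa [show n - (i + 1) + 2 = n - i + 1 by omega])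
    rw [hk] at h2
    exact ⟨_, (R.d i).rangeRestrict, LinearMap.surjective_rangeRestrict _,
      (LinearMap.ker_rangeRestrict _).trans (LinearMap.exact_iff.1 (R.exact_succ i)), h2⟩

variable (hR : ∀ (i : ℕ) (s : R.ι i), R.deg i s = i)
include hR

/-- The kernel is the image of `P (i + 2)` in degree `i + 1`, which is zero because the generators
of `P (i + 2)` have degree `i + 2`. -/
theorem dDegree_injective (i : ℕ) : Function.Injective (R.dDegree i (i + 1)) := by
  refine (LinearMap.ker_eq_bot (R := K) (M := freeComponent 𝒜 (R.deg (i + 1)) (i + 1))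
    (M₂ := freeComponent 𝒜 (R.deg i) (i + 1))).1 ?_
  rw [← R.range_dDegree_succ, LinearMap.range_eq_bot]
  ext ⟨x, hx⟩ : 1
  rw [freeComponent_eq_bot 𝒜 (fun s => by rw [hR]; push_cast; linarith), Submodule.mem_bot] at hx
  subst hx
  exact map_zero _

theorem εDegree_zero_injective : Function.Injective (R.εDegree 0) := by
  refine (LinearMap.ker_eq_bot (R := K) (M := freeComponent 𝒜 (R.deg 0) 0)
    (M₂ := TrivialModule 𝒜)).1 ?_
  rw [← R.range_dDegree_zero, LinearMap.range_eq_bot]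
  ext ⟨x, hx⟩ : 1
  rw [freeComponent_eq_bot 𝒜 (fun s => by rw [hR]; simp), Submodule.mem_bot] at hx
  subst hx
  exact map_zero _

theorem single_one_mem {i : ℕ} (t : R.ι i) :
    Finsupp.single t (1 : A) ∈ freeComponent 𝒜 (R.deg i) i := by
  refine single_mem_freeComponent 𝒜 _ ?_
  rw [hR, sub_self]
  exact (intComponent_natCast 𝒜 0).symm ▸ SetLike.GradedOne.one_mem

theorem d_single_one_ne_zero [Nontrivial A] {i : ℕ} (t : R.ι (i + 1)) :
    R.d i (Finsupp.single t 1) ≠ 0 := by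
  intro h
  have h2 := R.dDegree_injective hR i
    (a₁ := ⟨Finsupp.single t 1, by exact_mod_cast R.single_one_mem hR t⟩) (a₂ := 0)
    (Subtype.ext (h.trans (by rw [map_zero]; rfl)))
  have h3 := DFunLike.congr_fun (congrArg Subtype.val h2) t
  simp at h3

/-- A linear resolution is minimal, so that it is no longer than the projective dimension. -/
theorem isEmpty_of_hasProjectiveDimensionLT [Nontrivial A] {d : ℕ}
    (h : HasProjectiveDimensionLT (ModuleCat.of A (TrivialModule 𝒜)) (d + 1)) :
    IsEmpty (R.ι (d + 1)) := by
  refine ⟨fun t => R.d_single_one_ne_zero hR t ?_⟩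
  obtain ⟨M, f, hf, hk, hM⟩ := R.exists_syzygy h d le_rfl
  rw [Nat.sub_self, zero_add, ← projective_iff_hasProjectiveDimensionLT_one] at hM
  have : Module.Projective A M := (IsProjective.iff_projective M).2 hM
  obtain ⟨g, hg⟩ := Module.projective_lifting_property f LinearMap.id hf
  have hg' (x) : f (g x) = x := LinearMap.congr_fun hg x
  -- The `d`-th syzygy `M` is projective, so `f` splits, and `π` is the resulting projection of `P
  -- d` onto the image of `P (d + 1)`.
  let π : (R.ι d →₀ A) →ₗ[A] (R.ι d →₀ A) := LinearMap.id - g ∘ₗ f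
  have hπ (x) : ∃ y, R.d d y = π x := by
    rw [← LinearMap.mem_range, ← hk, LinearMap.mem_ker]
    simp [π, hg']
  choose y hy using hπ
  set x := R.d d (Finsupp.single t 1) with hx
  have hxmem : x ∈ freeComponent 𝒜 (R.deg d) (d + 1) :=
    R.d_homogeneous d _ _ (by exact_mod_cast R.single_one_mem hR t)
  have hπx : π x = x := by
    have : f x = 0 := by rw [← LinearMap.mem_ker, hk]; exact LinearMap.mem_range_self _ _
    simp [π, this]
  -- The choice `y` need not be linear, so only its values on basis vectors are used and extended
  -- linearly; then `z` maps to `π x = x`.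
  set z := x.sum fun s a => a • y (Finsupp.single s 1) with hz
  have hdz : R.d d z = x := by
    rw [hz, map_finsuppSum]
    simp_rw [map_smul, hy, ← map_smul]
    rw [← map_finsuppSum]
    conv_rhs => rw [← hπx, ← Finsupp.sum_single x]
    simp
  -- The coefficients of `x` have degree `1`, so those of `z` have no part of degree `0`, whereas
  -- degree `d + 1` of `P (d + 1)` sees exactly that part. Hence `x`, homogeneous of degree `d + 1`,
  -- vanishes.
  have hz0 : freeProj 𝒜 (R.deg (d + 1)) (d + 1) z = 0 := by
    rw [hz, map_finsuppSum]
    refine Finset.sum_eq_zero fun s _ => ?_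
    ext t'
    have hs : x s ∈ 𝒜 1 := by
      have := hxmem s
      rwa [hR, add_sub_cancel_left, ← Nat.cast_one, intComponent_natCast] at this
    rw [freeProj_apply, hR]
    push_cast
    rw [sub_self]
    change intProj 𝒜 0 (x s * y (Finsupp.single s 1) t') = 0
    rw [intProj, if_pos le_rfl, GradedAlgebra.proj_apply]
    exact DirectSum.coe_decompose_mul_of_left_mem_of_not_le 𝒜 hs (by simp)
  have := map_freeProj 𝒜 (R.d d) (R.d_homogeneous d) (d + 1) z
  rwa [hz0, hdz, freeProj_of_mem 𝒜 hxmem, if_pos rfl, map_zero, eq_comm] at this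

theorem finite_ι_of_finite_freeComponent [Nontrivial A] (i : ℕ)
    (h : Module.Finite K (freeComponent 𝒜 (R.deg i) i)) : Finite (R.ι i) := by
  have hli : LinearIndependent K fun t : R.ι i =>
      (⟨Finsupp.single t 1, R.single_one_mem hR t⟩ : freeComponent 𝒜 (R.deg i) i) := by
    refine LinearIndependent.of_comp (Submodule.subtype _) ?_
    rw [linearIndependent_iff]
    intro l hl
    ext t
    have := DFunLike.congr_fun hl t
    rw [Finsupp.linearCombination_apply, Finsupp.sum_apply] at this
    classical
    simpa [Finsupp.sum, Finsupp.single_apply, Algebra.smul_def] using this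
  exact hli.finite

theorem finite_freeComponent (hA : IsStandardGraded 𝒜) (i : ℕ) [Finite (R.ι i)] (n : ℤ) :
    Module.Finite K (freeComponent 𝒜 (R.deg i) n) := by
  have : Module.Finite K (intComponent 𝒜 (n - i)) := by
    obtain h | h := lt_or_ge (n - i) 0
    · rw [intComponent_of_neg 𝒜 h]; infer_instance
    · rw [← Int.toNat_of_nonneg h, intComponent_natCast]; exact hA.locallyFinite _
  exact Module.Finite.equiv (freeComponentEquiv 𝒜 (hR i) n).symm

/-- The basis of `P (i + 1)` is linearly independent over `K` in degree `i + 1`, and this component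
embeds in the one of `P i`, finite-dimensional by induction. The induction starts from the
one-dimensional trivial module. -/
theorem finite_ι (hA : IsStandardGraded 𝒜) (i : ℕ) : Finite (R.ι i) := by
  have := hA.nontrivial
  induction i with
  | zero =>
    have : Module.Finite K (TrivialModule 𝒜) :=
      Module.finite_of_finrank_eq_succ (finrank_trivialModule 𝒜 hA)
    exact R.finite_ι_of_finite_freeComponent hR 0
      (Module.Finite.of_injective _ (R.εDegree_zero_injective hR))
  | succ i ih =>
    refine R.finite_ι_of_finite_freeComponent hR (i + 1) ?_
    have := R.finite_freeComponent hR hA i (i + 1)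
    have : IsNoetherian K (freeComponent 𝒜 (R.deg i) (i + 1)) :=
      isNoetherian_of_isNoetherianRing_of_finite (R := K)
        (M := freeComponent 𝒜 (R.deg i) (i + 1))
    push_cast
    exact Module.Finite.of_injective _ (R.dDegree_injective hR i)

theorem finrank_freeComponent (hA : IsStandardGraded 𝒜) (i : ℕ) (n : ℤ) :
    Module.finrank K (freeComponent 𝒜 (R.deg i) n) =
      Nat.card (R.ι i) * Module.finrank K (intComponent 𝒜 (n - i)) := by
  have := R.finite_ι hR hA i
  have := Fintype.ofFinite (R.ι i)
  rw [(freeComponentEquiv 𝒜 (hR i) n).finrank_eq, Module.finrank_finsupp, Nat.card_eq_fintype_card]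

/-- The Euler characteristic of a truncation of the resolution in degree `n`. -/
theorem sum_finrank_freeComponent (hA : IsStandardGraded 𝒜) (n : ℤ) (N : ℕ) :
    ∑ i ∈ Finset.range (N + 1),
      (-1 : ℤ) ^ i * Module.finrank K (freeComponent 𝒜 (R.deg i) n) =
    (if n = 0 then 1 else 0) +
      (-1) ^ N * Module.finrank K (LinearMap.range (R.dDegree N n)) := by
  have hfin (i : ℕ) : Module.Finite K (freeComponent 𝒜 (R.deg i) n) :=
    have := R.finite_ι hR hA i
    R.finite_freeComponent hR hA i n
  induction N with
  | zero =>
    have h := LinearMap.finrank_range_add_finrank_ker (K := K)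
      (V := freeComponent 𝒜 (R.deg 0) n) (V₂ := TrivialModule 𝒜) (R.εDegree n)
    rw [← R.range_dDegree_zero] at h
    have h2 : Module.finrank K (LinearMap.range (R.εDegree n)) = if n = 0 then 1 else 0 := by
      split_ifs with hn
      · subst hn
        rw [LinearMap.range_eq_top.2 R.εDegree_zero_surjective, finrank_top,
          finrank_trivialModule 𝒜 hA]
      · rw [R.εDegree_of_ne hn, LinearMap.range_zero, finrank_bot]
    rw [h2] at h
    simp [← h]
  | succ N ih =>
    have h := LinearMap.finrank_range_add_finrank_ker (K := K)
      (V := freeComponent 𝒜 (R.deg (N + 1)) n) (V₂ := freeComponent 𝒜 (R.deg N) n) (R.dDegree N n)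
    rw [← R.range_dDegree_succ] at h
    rw [Finset.sum_range_succ, ih, ← h]
    push_cast
    ring

/-- The Hilbert series of a Koszul algebra with a linear resolution of length `d`. -/
theorem sum_card_mul_finrank (hA : IsStandardGraded 𝒜) {d : ℕ} (hd : IsEmpty (R.ι (d + 1)))
    (n : ℕ) :
    ∑ i ∈ Finset.range (d + 1), (-1 : ℤ) ^ i * Nat.card (R.ι i) *
      (if i ≤ n then (Module.finrank K (𝒜 (n - i)) : ℤ) else 0) = if n = 0 then 1 else 0 := by
  have h := R.sum_finrank_freeComponent hR hA n d
  -- The error term of the truncated Euler characteristic is the image of `P (d + 1) = 0`.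
  have h0 : LinearMap.range (R.dDegree d n) = ⊥ := by
    rw [LinearMap.range_eq_bot]
    ext x : 1
    have : x = 0 := Subsingleton.elim _ _
    rw [this, map_zero, map_zero]
  rw [h0, finrank_bot, Nat.cast_zero, mul_zero, add_zero] at h
  simp only [Nat.cast_eq_zero] at h
  rw [← h]
  refine Finset.sum_congr rfl fun i _ => ?_
  rw [R.finrank_freeComponent hR hA, mul_assoc, Nat.cast_mul]
  congr 2
  split_ifs with hin
  · rw [← Nat.cast_sub hin, intComponent_natCast]
  · rw [finrank_intComponent_of_lt 𝒜 (by omega), Nat.cast_zero]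

end GradedFreeResolution

/-! ### Gelfand-Kirillov dimension and partial sums of the Hilbert function -/

section Growth

variable {K : Type u} {A : Type v} [Field K] [Ring A] [Algebra K A] (𝒜 : ℕ → Submodule K A)

/-- The elements of `A` of degree at most `s`. -/
def filtration (s : ℕ) : Submodule K A := ⨆ i : Fin (s + 1), 𝒜 i

theorem le_filtration {i s : ℕ} (h : i ≤ s) : 𝒜 i ≤ filtration 𝒜 s :=
  le_iSup (fun i : Fin (s + 1) => 𝒜 i) ⟨i, Nat.lt_succ_of_le h⟩

theorem filtration_mono : Monotone (filtration 𝒜) := fun _ _ h =>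
  iSup_le fun i => le_filtration 𝒜 ((Nat.le_of_lt_succ i.2).trans h)

theorem filtration_succ (s : ℕ) : filtration 𝒜 (s + 1) = filtration 𝒜 s ⊔ 𝒜 (s + 1) := by
  refine le_antisymm (iSup_le fun i => ?_)
    (sup_le (filtration_mono 𝒜 s.le_succ) (le_filtration 𝒜 le_rfl))
  obtain h | h := Nat.le_succ_iff.1 (Nat.le_of_lt_succ i.2)
  · exact (le_filtration 𝒜 h).trans le_sup_left
  · rw [h]; exact le_sup_right

theorem finite_filtration (hfin : ∀ n, Module.Finite K (𝒜 n)) (s : ℕ) :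
    Module.Finite K (filtration 𝒜 s) := by
  unfold filtration
  infer_instance

theorem finrank_filtration_le (hfin : ∀ n, Module.Finite K (𝒜 n)) (s : ℕ) :
    Module.finrank K (filtration 𝒜 s) ≤
      ∑ i ∈ Finset.range (s + 1), Module.finrank K (𝒜 i) := by
  induction s with
  | zero =>
    have : filtration 𝒜 0 = 𝒜 0 :=
      le_antisymm (iSup_le fun i => by rw [Fin.val_eq_zero i]) (le_filtration 𝒜 le_rfl)
    rw [this, zero_add, Finset.sum_range_one]
  | succ s ih =>
    rw [Finset.sum_range_succ, filtration_succ]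
    have := finite_filtration 𝒜 hfin s
    exact (Submodule.finrank_add_le_finrank_add_finrank _ _).trans (Nat.add_le_add_right ih _)

variable [GradedAlgebra 𝒜]

theorem filtration_mul_le (s t : ℕ) : filtration 𝒜 s * filtration 𝒜 t ≤ filtration 𝒜 (s + t) := by
  unfold filtration
  rw [Submodule.iSup_mul]
  refine iSup_le fun i => ?_
  rw [Submodule.mul_iSup]
  refine iSup_le fun j => ?_
  refine le_trans ?_ (le_filtration 𝒜
    (Nat.add_le_add (Nat.le_of_lt_succ i.2) (Nat.le_of_lt_succ j.2)))
  exact Submodule.mul_le.2 fun a ha b hb => SetLike.mul_mem_graded ha hb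

theorem filtration_pow_le (s n : ℕ) : filtration 𝒜 s ^ n ≤ filtration 𝒜 (s * n) := by
  induction n with
  | zero =>
    rw [pow_zero]
    refine le_trans ?_ (le_filtration 𝒜 (Nat.zero_le _))
    rw [Submodule.one_le]
    exact SetLike.GradedOne.one_mem
  | succ n ih =>
    rw [pow_succ, mul_add, mul_one]
    exact (mul_le_mul' ih le_rfl).trans (filtration_mul_le 𝒜 _ _)

theorem exists_mem_filtration (a : A) : ∃ s, a ∈ filtration 𝒜 s := by
  induction a using DirectSum.Decomposition.inductionOn 𝒜 with
  | zero => exact ⟨0, zero_mem _⟩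
  | @homogeneous i m => exact ⟨i, le_filtration 𝒜 le_rfl m.2⟩
  | add m m' h h' =>
    obtain ⟨s, hs⟩ := h
    obtain ⟨t, ht⟩ := h'
    exact ⟨max s t, add_mem (filtration_mono 𝒜 (le_max_left s t) hs)
      (filtration_mono 𝒜 (le_max_right s t) ht)⟩

theorem exists_le_filtration {V : Submodule K A} (hV : V.FG) : ∃ s, V ≤ filtration 𝒜 s := by
  obtain ⟨S, rfl⟩ := hV
  choose s hs using exists_mem_filtration 𝒜
  refine ⟨S.sup s, Submodule.span_le.2 fun a ha => ?_⟩
  exact filtration_mono 𝒜 (Finset.le_sup (f := s) ha) (hs a)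

theorem tendsto_logb_const_mul_pow {C : ℝ} (hC : 0 < C) (m : ℕ) :
    Filter.Tendsto (fun n : ℕ => Real.logb n (C * (n : ℝ) ^ m)) Filter.atTop (nhds m) := by
  have h1 : Filter.Tendsto (fun n : ℕ => Real.log C / Real.log n + m) Filter.atTop
      (nhds (0 + (m : ℝ))) :=
    ((Real.tendsto_log_atTop.comp tendsto_natCast_atTop_atTop).const_div_atTop _).add_const _
  rw [zero_add] at h1
  refine h1.congr' ?_
  filter_upwards [Filter.eventually_ge_atTop 2] with n hn
  have hn' : (1 : ℝ) < n := by exact_mod_cast hn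
  have := Real.log_pos hn'
  rw [Real.logb, Real.log_mul hC.ne' (by positivity), Real.log_pow]
  field_simp

/-- Polynomial growth of degree `m` of the partial sums of the Hilbert function bounds the
Gelfand-Kirillov dimension by `m`. -/
theorem gkDim_le [Nontrivial A] (hfin : ∀ n, Module.Finite K (𝒜 n)) {C : ℝ} {m N₀ : ℕ}
    (h : ∀ N ≥ N₀, ((∑ i ∈ Finset.range (N + 1), Module.finrank K (𝒜 i) : ℕ) : ℝ) ≤
      C * (N : ℝ) ^ m) : gkDim K A ≤ ((m : ℝ) : EReal) := by
  refine iSup_le fun V => iSup_le fun hV => iSup_le fun h1 => ?_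
  obtain ⟨s, hs⟩ := exists_le_filtration 𝒜 hV
  -- Passing to `s + 1` guarantees `(s + 1) * n ≥ n ≥ N₀` even when `s = 0`; likewise `max C 1`
  -- below keeps the constant positive for the logarithm.
  have hs' := hs.trans (filtration_mono 𝒜 s.le_succ)
  set C' : ℝ := max C 1 * (s + 1 : ℝ) ^ m
  have hC' : 0 < C' := by positivity
  rw [← ((continuous_coe_real_ereal.tendsto _).comp (tendsto_logb_const_mul_pow hC' m)).limsup_eq]
  refine Filter.limsup_le_limsup ?_
  filter_upwards [Filter.eventually_ge_atTop (max N₀ 2)] with n hn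
  have hn2 : 2 ≤ n := (le_max_right _ _).trans hn
  have hn' : (1 : ℝ) < n := by exact_mod_cast hn2
  have hfil := finite_filtration 𝒜 hfin ((s + 1) * n)
  have hle : V ^ n ≤ filtration 𝒜 ((s + 1) * n) :=
    (pow_le_pow_left' hs' n).trans (filtration_pow_le 𝒜 _ _)
  have hpos : 0 < Module.finrank K ↥(V ^ n) := by
    have := Submodule.finiteDimensional_of_le hle
    have h1n : (1 : A) ∈ V ^ n := by simpa using Submodule.pow_mem_pow V h1 n
    have : Nontrivial ↥(V ^ n) := ⟨⟨1, h1n⟩, 0, fun h => one_ne_zero (congrArg Subtype.val h)⟩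
    exact Module.finrank_pos
  refine EReal.coe_le_coe_iff.2 (Real.logb_le_logb_of_le hn' (by exact_mod_cast hpos) ?_)
  calc (Module.finrank K ↥(V ^ n) : ℝ)
      ≤ ((∑ i ∈ Finset.range ((s + 1) * n + 1), Module.finrank K (𝒜 i) : ℕ) : ℝ) := by
        exact_mod_cast (Submodule.finrank_mono hle).trans (finrank_filtration_le 𝒜 hfin _)
    _ ≤ C * (((s + 1) * n : ℕ) : ℝ) ^ m :=
        h _ (((le_max_left _ _).trans hn).trans (Nat.le_mul_of_pos_left _ s.succ_pos))
    _ ≤ max C 1 * (((s + 1) * n : ℕ) : ℝ) ^ m := by gcongr; exact le_max_left _ _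
    _ = C' * (n : ℝ) ^ m := by simp only [C']; push_cast; rw [mul_pow]; ring

end Growth

/-! ### Power series inverse to a polynomial -/

section Analysis

open Polynomial

/-- Comparison with `n ^ ⌈e⌉₊ * |t| ^ n`, which trades the real exponent for a natural one. -/
theorem summable_of_polynomial_growth {a : ℕ → ℕ} {c e : ℝ}
    (h : ∀ n : ℕ, 1 ≤ n → (a n : ℝ) ≤ c * (n : ℝ) ^ e) {t : ℝ} (ht : |t| < 1) :
    Summable fun n => ‖(a n : ℝ) * t ^ n‖ := by
  have h1 := (summable_pow_mul_geometric_of_norm_lt_one ⌈e⌉₊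
    (show ‖|t|‖ < 1 by simpa using ht)).mul_left |c|
  refine (h1.of_norm_bounded_eventually_nat ?_)
  filter_upwards [Filter.eventually_ge_atTop 1] with n hn
  have hn' : (1 : ℝ) ≤ n := by exact_mod_cast hn
  rw [norm_norm, norm_mul, norm_pow, Real.norm_natCast, Real.norm_eq_abs, ← mul_assoc]
  gcongr
  calc (a n : ℝ) ≤ c * (n : ℝ) ^ e := h n hn
    _ ≤ |c| * (n : ℝ) ^ e := by gcongr; exact le_abs_self c
    _ ≤ |c| * (n : ℝ) ^ ⌈e⌉₊ := by
      gcongr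
      rw [← Real.rpow_natCast]
      exact Real.rpow_le_rpow_of_exponent_le hn' (Nat.le_ceil e)

/-- The formal identity passes to values through the Cauchy product of absolutely convergent series.
-/
theorem eval_mul_tsum_eq_one {q : ℝ[X]} {a : ℕ → ℕ}
    (h : (q : PowerSeries ℝ) * PowerSeries.mk (fun n => (a n : ℝ)) = 1) {t : ℝ}
    (hs : Summable fun n => ‖(a n : ℝ) * t ^ n‖) : q.eval t * ∑' n, (a n : ℝ) * t ^ n = 1 := by
  have h0 : ∀ n ∉ Finset.range (q.natDegree + 1), q.coeff n * t ^ n = 0 := fun n hn => by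
    rw [q.coeff_eq_zero_of_natDegree_lt (by simpa using hn), zero_mul]
  have hq : q.eval t = ∑' n, q.coeff n * t ^ n := by
    rw [tsum_eq_sum h0, eval_eq_sum_range]
  have hqs : Summable fun n => ‖q.coeff n * t ^ n‖ :=
    summable_of_ne_finset_zero (s := Finset.range (q.natDegree + 1))
      fun n hn => by rw [h0 n hn, norm_zero]
  rw [hq, tsum_mul_tsum_eq_tsum_sum_antidiagonal_of_summable_norm hqs hs]
  have (n : ℕ) : ∑ kl ∈ Finset.HasAntidiagonal.antidiagonal n, q.coeff kl.1 * t ^ kl.1 * (a kl.2 * t ^ kl.2) =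
      if n = 0 then 1 else 0 := by
    have h1 := congrArg (PowerSeries.coeff n) h
    rw [PowerSeries.coeff_mul, PowerSeries.coeff_one] at h1
    simp only [PowerSeries.coeff_mk, Polynomial.coeff_coe] at h1
    calc _ = (∑ kl ∈ Finset.HasAntidiagonal.antidiagonal n, q.coeff kl.1 * a kl.2) * t ^ n := by
          rw [Finset.sum_mul]
          refine Finset.sum_congr rfl fun kl hkl => ?_
          rw [← Finset.HasAntidiagonal.mem_antidiagonal.1 hkl]
          ring
      _ = _ := by rw [h1]; split_ifs with hn <;> simp [hn]
  simp_rw [this, tsum_ite_eq]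

/-- A power series with nonnegative coefficients that is the inverse of a polynomial `q` has partial
sums of coefficients that grow at most like `N ^ m`, for `m` the multiplicity of the root `1`. -/
theorem exists_sum_range_le {q : ℝ[X]} {a : ℕ → ℕ}
    (hs : ∀ t : ℝ, |t| < 1 → Summable fun n => ‖(a n : ℝ) * t ^ n‖)
    (hq : ∀ t : ℝ, |t| < 1 → q.eval t * ∑' n, (a n : ℝ) * t ^ n = 1) :
    ∃ (C : ℝ) (N₀ : ℕ), ∀ N ≥ N₀, ((∑ i ∈ Finset.range (N + 1), a i : ℕ) : ℝ) ≤
      C * (N : ℝ) ^ q.rootMultiplicity 1 := by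
  have hq0 : q ≠ 0 := by
    rintro rfl
    simpa using hq 0 (by simp)
  obtain ⟨g, hg, hdvd⟩ := q.exists_eq_pow_rootMultiplicity_mul_and_not_dvd hq0 1
  set m := q.rootMultiplicity 1
  rw [dvd_iff_isRoot, IsRoot.def] at hdvd
  have hlim : Filter.Tendsto (fun N : ℕ => |g.eval ((N : ℝ) / (N + 1))|) Filter.atTop
      (nhds |g.eval 1|) :=
    (g.continuous.abs.tendsto 1).comp (tendsto_natCast_div_add_atTop (1 : ℝ))
  have hev := hlim.eventually_const_le (half_lt_self (abs_pos.2 hdvd))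
  obtain ⟨N₀, hN₀⟩ := Filter.eventually_atTop.1 hev
  -- The series is evaluated at `t = N / (N + 1)`. The factors come from `t ^ (-N) ≤ e`, from
  -- `|g(t)| ≥ |g(1)| / 2`, and from `N + 1 ≤ 2 N`.
  refine ⟨Real.exp 1 * (2 / |g.eval 1|) * 2 ^ m, max N₀ 1, fun N hN => ?_⟩
  have hN1 : (1 : ℝ) ≤ N := by exact_mod_cast (le_max_right _ _).trans hN
  have hgN := hN₀ N ((le_max_left _ _).trans hN)
  set t : ℝ := (N : ℝ) / (N + 1) with ht
  have ht0 : 0 < t := by positivity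
  have ht1 : t < 1 := by rw [ht, div_lt_one (by positivity)]; linarith
  have hta : |t| < 1 := by rwa [abs_of_pos ht0]
  have hpow : 1 ≤ Real.exp 1 * t ^ N := by
    have h1 : t⁻¹ ≤ Real.exp (1 / N) := by
      refine le_trans (le_of_eq ?_) (Real.add_one_le_exp _)
      rw [ht]; field_simp; ring
    have h2 : (t⁻¹) ^ N ≤ Real.exp 1 := by
      calc (t⁻¹) ^ N ≤ Real.exp (1 / N) ^ N := by gcongr
        _ = Real.exp 1 := by rw [← Real.exp_nat_mul]; congr 1; field_simp
    calc (1 : ℝ) = (t⁻¹) ^ N * t ^ N := by rw [← mul_pow, inv_mul_cancel₀ ht0.ne', one_pow]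
      _ ≤ _ := by gcongr
  set H := ∑' n, (a n : ℝ) * t ^ n with hH
  have hH0 : 0 ≤ H := tsum_nonneg fun n => by positivity
  -- Each weight `t ^ i` with `i ≤ N` is at least `1 / e`, and the remaining terms of the series are
  -- nonnegative.
  have hsum : ((∑ i ∈ Finset.range (N + 1), a i : ℕ) : ℝ) ≤ Real.exp 1 * H := by
    push_cast
    calc ∑ i ∈ Finset.range (N + 1), (a i : ℝ)
        ≤ ∑ i ∈ Finset.range (N + 1), Real.exp 1 * ((a i : ℝ) * t ^ i) := by
          refine Finset.sum_le_sum fun i hi => ?_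
          have : t ^ N ≤ t ^ i :=
            pow_le_pow_of_le_one ht0.le ht1.le (Nat.lt_succ_iff.1 (Finset.mem_range.1 hi))
          have h3 : 1 ≤ Real.exp 1 * t ^ i := hpow.trans (by gcongr)
          calc (a i : ℝ) = a i * 1 := (mul_one _).symm
            _ ≤ a i * (Real.exp 1 * t ^ i) := by gcongr
            _ = _ := by ring
      _ = Real.exp 1 * ∑ i ∈ Finset.range (N + 1), (a i : ℝ) * t ^ i := by rw [Finset.mul_sum]
      _ ≤ Real.exp 1 * H := by
          gcongr
          exact (hs t hta).of_norm.sum_le_tsum _ fun n _ => by positivity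
  -- Here `|t - 1| = 1 / (N + 1)`, so the factor `(t - 1) ^ m` of `q` accounts for the whole growth.
  have hHq : H * |g.eval t| = (N + 1 : ℝ) ^ m := by
    have h1 := congrArg abs (hq t hta)
    rw [abs_mul, abs_one, abs_of_nonneg hH0, hg, eval_mul, eval_pow, eval_sub, eval_X, eval_C,
      abs_mul, abs_pow, abs_of_neg (by linarith : t - 1 < 0),
      show -(t - 1) = (N + 1 : ℝ)⁻¹ by rw [ht]; field_simp; ring, inv_pow] at h1
    field_simp at h1
    linarith
  have hg1 : 0 < |g.eval 1| := abs_pos.2 hdvd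
  have hHle : H ≤ 2 / |g.eval 1| * (N + 1 : ℝ) ^ m := by
    rw [← hHq, div_mul_eq_mul_div, le_div_iff₀ hg1]
    nlinarith
  calc _ ≤ Real.exp 1 * H := hsum
    _ ≤ Real.exp 1 * (2 / |g.eval 1| * (2 * N : ℝ) ^ m) := by
        gcongr
        refine hHle.trans ?_
        gcongr
        linarith
    _ = _ := by rw [mul_pow]; ring

/-- An integral polynomial of degree `d` with constant term `1`, with leading coefficient of sign
`(-1) ^ d`, with a root of multiplicity at least `d - 1` at `1`, and without roots in `(0, 1)`. -/
theorem eq_one_sub_X_pow {p : ℤ[X]} {d b : ℕ} (hdeg : p.natDegree ≤ d) (h0 : p.coeff 0 = 1)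
    (hd : p.coeff d = (-1) ^ d * b) (hb : 1 ≤ b)
    (hm : d ≤ (p.map (Int.castRingHom ℝ)).rootMultiplicity 1 + 1)
    (hroot : ∀ t : ℝ, 0 < t → t < 1 → (p.map (Int.castRingHom ℝ)).eval t ≠ 0) :
    p = (1 - X) ^ d := by
  apply map_injective (Int.castRingHom ℝ) Int.cast_injective
  simp only [Polynomial.map_pow, Polynomial.map_sub, Polynomial.map_one, map_X]
  set P := p.map (Int.castRingHom ℝ)
  have hPdeg : P.natDegree ≤ d := natDegree_map_le.trans hdeg
  have hP0 : P.coeff 0 = 1 := by simp [P, h0]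
  have hPd : P.coeff d = (-1) ^ d * b := by simp [P, hd]
  cases d with
  | zero => rw [eq_C_of_natDegree_le_zero hPdeg, hP0]; simp
  | succ k =>
    have hmonic : ((X - C 1 : ℝ[X]) ^ k).Monic := (monic_X_sub_C 1).pow k
    have hnat : ((X - C 1 : ℝ[X]) ^ k).natDegree = k := by
      rw [natDegree_pow, natDegree_X_sub_C, mul_one]
    obtain ⟨g, hg⟩ : (X - C 1 : ℝ[X]) ^ k ∣ P :=
      (pow_dvd_pow _ (by omega)).trans (pow_rootMultiplicity_dvd P 1)
    have hP : P ≠ 0 := by rintro h; simp [h] at hP0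
    have hg0 : g ≠ 0 := by rintro rfl; simp at hg; exact hP hg
    -- Only a linear factor is left; the top and constant coefficients of `P` determine it.
    have hgdeg : g.natDegree ≤ 1 := by
      rw [hg, hmonic.natDegree_mul' hg0, hnat] at hPdeg
      omega
    have hu : g.coeff 1 = (-1) ^ (k + 1) * b := by
      rw [← hPd, hg, coeff_mul_add_eq_of_natDegree_le hnat.le hgdeg]
      nth_rw 2 [← hnat]
      rw [hmonic.coeff_natDegree, one_mul]
    have hv : g.coeff 0 = (-1) ^ k := by
      rw [hg, mul_coeff_zero] at hP0
      simp only [coeff_zero_eq_eval_zero, eval_pow, eval_sub, eval_X, eval_C, zero_sub] at hP0 ⊢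
      calc eval 0 g = (-1) ^ k * ((-1) ^ k * eval 0 g) := by
            rw [← mul_assoc, ← mul_pow]; simp
        _ = _ := by rw [hP0, mul_one]
    have hgX : g = C ((-1) ^ (k + 1) * (b : ℝ)) * X + C ((-1) ^ k) := by
      rw [← hu, ← hv]; exact eq_X_add_C_of_natDegree_le_one hgdeg
    -- Now `g = (-1) ^ (k + 1) * (b X - 1)`, with root `1 / b`, which lies in the forbidden interval
    -- as soon as `b > 1`.
    obtain rfl | hb2 := hb.eq_or_lt
    · rw [hg, hgX]
      have : (X - C 1 : ℝ[X]) = -1 * (1 - X) := by simp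
      rw [this, mul_pow]
      simp only [map_pow, map_neg, map_one, Nat.cast_one, mul_one]
      have h1 : ((-1 : ℝ[X]) ^ k) * (-1) ^ k = 1 := by rw [← mul_pow]; simp
      linear_combination (1 - X : ℝ[X]) ^ (k + 1) * h1
    · have hb' : (1 : ℝ) < b := by exact_mod_cast hb2
      refine absurd ?_ (hroot (b : ℝ)⁻¹ (by positivity) (inv_lt_one_of_one_lt₀ hb'))
      rw [hg, hgX, eval_mul]
      have : (b : ℝ) ≠ 0 := by positivity
      simp [pow_succ, this]

end Analysis

/-! ### The Euler polynomial of an Artin-Schelter regular Koszul algebra -/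

section Main

open Polynomial

variable {K : Type u} {A : Type v} [Field K] [Ring A] [Algebra K A]
  {𝒜 : ℕ → Submodule K A} [GradedAlgebra 𝒜]

theorem hasProjectiveDimensionLT_of_globalDimension_eq {d : ℕ} (h : globalDimension A = d)
    (M : ModuleCat.{v} A) : HasProjectiveDimensionLT M (d + 1) :=
  (projectiveDimension_le_iff M d).1 (h ▸ le_iSup projectiveDimension M)

namespace GradedFreeResolution

variable (R : GradedFreeResolution 𝒜)

/-- `Ext` is a subspace of a quotient of `Hom(P i, A)`, so it vanishes when `P i = 0`. For `i = d`
this yields `b_d ≥ 1`. -/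
theorem nonempty_of_finrank_Ext {i : ℕ} {n : ℤ} (h : Module.finrank K (R.Ext i n) = 1) :
    Nonempty (R.ι i) := by
  by_contra hne
  rw [not_nonempty_iff] at hne
  have : Subsingleton ((R.ι i →₀ A) →ₗ[A] A) :=
    ⟨fun f g => LinearMap.ext fun x => by rw [Subsingleton.elim x 0, map_zero, map_zero]⟩
  have : Subsingleton (((R.ι i →₀ A) →ₗ[A] A) ⧸ R.coboundaries i n) :=
    (Submodule.mkQ_surjective _).subsingleton
  rw [Module.finrank_zero_of_subsingleton] at h
  exact zero_ne_one h

/-- The Euler polynomial `∑ i ≤ d, (-1) ^ i b_i X ^ i` of a resolution, for `b_i` the rank of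
`P i`. -/
def eulerPolynomial (d : ℕ) : ℤ[X] :=
  ∑ i ∈ Finset.range (d + 1), C ((-1) ^ i * (Nat.card (R.ι i) : ℤ)) * X ^ i

theorem natDegree_eulerPolynomial_le (d : ℕ) : (R.eulerPolynomial d).natDegree ≤ d :=
  natDegree_sum_le_of_forall_le _ _ fun _ hi =>
    (natDegree_C_mul_X_pow_le _ _).trans (Nat.lt_succ_iff.1 (Finset.mem_range.1 hi))

theorem coeff_eulerPolynomial {d i : ℕ} (hi : i ≤ d) :
    (R.eulerPolynomial d).coeff i = (-1) ^ i * (Nat.card (R.ι i) : ℤ) := by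
  rw [eulerPolynomial, finsetSum_coeff]
  simp_rw [coeff_C_mul, coeff_X_pow]
  simp [Nat.lt_succ_iff.2 hi]

theorem eulerPolynomial_mul_hilbertSeries (hR : ∀ (i : ℕ) (s : R.ι i), R.deg i s = i)
    (hA : IsStandardGraded 𝒜) {d : ℕ} (hd : IsEmpty (R.ι (d + 1))) :
    (R.eulerPolynomial d : PowerSeries ℤ) *
      PowerSeries.mk (fun n => (Module.finrank K (𝒜 n) : ℤ)) = 1 := by
  ext n
  rw [PowerSeries.coeff_one, ← R.sum_card_mul_finrank hR hA hd n, eulerPolynomial,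
    ← Polynomial.coeToPowerSeries.ringHom_apply, map_sum, Finset.sum_mul, map_sum]
  refine Finset.sum_congr rfl fun i _ => ?_
  rw [Polynomial.coeToPowerSeries.ringHom_apply, coe_mul, coe_C, coe_pow, coe_X, mul_assoc,
    PowerSeries.coeff_C_mul, PowerSeries.coeff_X_pow_mul', PowerSeries.coeff_mk]

end GradedFreeResolution

theorem eulerPolynomial_eq {d : ℕ} (hA : IsStandardGraded 𝒜) (hreg : IsASRegular 𝒜 d)
    (hGK : (((d : ℝ) - 1 : ℝ) : EReal) ≤ gkDim K A) (R : GradedFreeResolution 𝒜)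
    (hR : ∀ (i : ℕ) (s : R.ι i), R.deg i s = i)
    (hmul : (R.eulerPolynomial d : PowerSeries ℤ) *
      PowerSeries.mk (fun n => (Module.finrank K (𝒜 n) : ℤ)) = 1) :
    R.eulerPolynomial d = (1 - X) ^ d := by
  have := hA.nontrivial
  obtain ⟨l, hl⟩ := hreg.gorenstein
  obtain ⟨c, e, -, -, hgrowth⟩ := hreg.polynomial_growth
  have hmulR := congrArg (PowerSeries.map (Int.castRingHom ℝ)) hmul
  rw [map_mul, map_one, ← Polynomial.polynomial_map_coe] at hmulR
  have hmk : PowerSeries.map (Int.castRingHom ℝ)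
      (PowerSeries.mk fun n => (Module.finrank K (𝒜 n) : ℤ)) =
      PowerSeries.mk fun n => (Module.finrank K (𝒜 n) : ℝ) := by
    ext n; simp
  rw [hmk] at hmulR
  have hs (t : ℝ) (ht : |t| < 1) := summable_of_polynomial_growth hgrowth ht
  have heval (t : ℝ) (ht : |t| < 1) := eval_mul_tsum_eq_one hmulR (hs t ht)
  obtain ⟨C, N₀, hC⟩ := exists_sum_range_le hs heval
  refine eq_one_sub_X_pow (b := Nat.card (R.ι d)) (R.natDegree_eulerPolynomial_le d) ?_
    (R.coeff_eulerPolynomial le_rfl) ?_ ?_ ?_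
  -- In degree `0` the identity reads `b_0 * dim A_0 = 1` in natural numbers, whence `b_0 = 1`.
  · have h := congrArg (PowerSeries.coeff 0) hmul
    rw [PowerSeries.coeff_mul, Finset.Nat.antidiagonal_zero, Finset.sum_singleton,
      Polynomial.coeff_coe, PowerSeries.coeff_mk, PowerSeries.coeff_zero_one,
      R.coeff_eulerPolynomial (Nat.zero_le d), pow_zero, one_mul] at h
    rw [R.coeff_eulerPolynomial (Nat.zero_le d), pow_zero, one_mul]
    exact_mod_cast Nat.eq_one_of_mul_eq_one_right (by exact_mod_cast h)
  · have := R.finite_ι hR hA d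
    have := R.nonempty_of_finrank_Ext (hl R).2
    exact Nat.card_pos
  · have h := hGK.trans (gkDim_le 𝒜 hA.locallyFinite hC)
    rw [EReal.coe_le_coe_iff, sub_le_iff_le_add] at h
    exact_mod_cast h
  · intro t ht0 ht1 h
    have := heval t (by rwa [abs_of_pos ht0])
    rw [h, zero_mul] at this
    exact zero_ne_one this

end Main

end
end ASKoszul

theorem corollary2p5 {K : Type u} {A : Type v} [Field K] [Ring A] [Algebra K A]
    (𝒜 : ℕ → Submodule K A) [GradedAlgebra 𝒜] (hA : ASKoszul.IsStandardGraded 𝒜)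
    (d : ℕ) (hreg : ASKoszul.IsASRegular 𝒜 d) (hkoszul : ASKoszul.IsKoszul 𝒜)
    (hGK : (((d : ℝ) - 1 : ℝ) : EReal) ≤ ASKoszul.gkDim K A) :
    ASKoszul.hilbertSeries 𝒜 = ((1 - PowerSeries.X : PowerSeries ℚ) ^ d)⁻¹ := by
  have := hA.nontrivial
  obtain ⟨R, hR⟩ := hkoszul
  have hmul := R.eulerPolynomial_mul_hilbertSeries hR hA
    (R.isEmpty_of_hasProjectiveDimensionLT hR
      (ASKoszul.hasProjectiveDimensionLT_of_globalDimension_eq hreg.globalDimension_eq _))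
  rw [ASKoszul.eulerPolynomial_eq hA hreg hGK R hR hmul] at hmul
  rw [PowerSeries.eq_inv_iff_mul_eq_one (by simp), mul_comm]
  have h := congrArg (PowerSeries.map (Int.castRingHom ℚ)) hmul
  have hmk : PowerSeries.map (Int.castRingHom ℚ)
      (PowerSeries.mk fun n => (Module.finrank K (𝒜 n) : ℤ)) = ASKoszul.hilbertSeries 𝒜 := by
    ext n; simp [ASKoszul.hilbertSeries]
  rw [map_mul, map_one, hmk, ← Polynomial.polynomial_map_coe] at h
  simpa using h
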